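/- Let $N\ge 1$ and let $\mathcal H=L^2(\mathbb R^N)$ be the Hilbert space of $N$ bosonic modes. Write points of the phase space $\mathbb R^{2N}$ as $\mathbf x=(q_1,p_1,\dots,q_N,p_N)^T$, let $\mathbf\Omega=\bigoplus_{j=1}^N\begin{pmatrix}0&1\\-1&0\end{pmatrix}$, and let $W(\mathbf x)=e^{-i\mathbf x^T\mathbf\Omega\mathbf R}$, $\mathbf R=(Q_1,P_1,\dots,Q_N,P_N)^T$, be the Weyl operators, that is, $(W(\mathbf x)\psi)(t)=e^{i(p\cdot t-p\cdot q/2)}\psi(t-q)$. An observable on $\mathbb R^M$ is a map $\mathsf E$ from the Borel sets of $\mathbb R^M$ to the positive bounded operators on $\mathcal H$ with $\mathsf E(\mathbb R^M)=I$ that is $\sigma$-additive in the weak operator topology. It is Gaussian with parameters $(\mathbf A_0,\mathbf B_0,\mathbf v_0)$, where $\mathbf A_0$ is a real $2N\times M$ matrix, $\mathbf B_0$ a real $M\times M$ matrix with $\mathbf B_0-i\mathbf A_0^T\mathbf\Omega\mathbf A_0\ge 0$ and $\mathbf v_0\in\mathbb R^M$, if $$\int e^{i\mathbf p^T\mathbf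 x}\,\mathsf E(d\mathbf x)=e^{-\frac14\mathbf p^T\mathbf B_0\mathbf p-i\mathbf v_0^T\mathbf p}\,W(\mathbf A_0\mathbf p)\qquad\text{for all }\mathbf p\in\mathbb R^M$$ in the weak sense; then put $X_{\mathsf E}=\{\mathbf A_0\mathbf p\mid\mathbf p\in\mathbb R^M\}\subset\mathbb R^{2N}$. A family of observables $(\mathsf E_j)_{j\in I}$ is informationally complete if any two states (positive operators of trace one) $\rho,\sigma$ on $\mathcal H$ with $\operatorname{tr}[\rho\,\mathsf E_j(X)]=\operatorname{tr}[\sigma\,\mathsf E_j(X)]$ for all $j\in I$ and all Borel sets $X$ are equal. Theorem. Let $(\mathsf E_j)_{j\in I}$ be an arbitrary family of Gaussian observables, $\mathsf E_j$ on $\mathbb R^{M_j}$ with parameters $(\mathbf A_0^j,\mathbf B_0^j,\mathbf v_0^j)$. Then $(\mathsf E_j)_{j\in I}$ is informationally complete if and only if $\bigcup_{j\in I}X_{\mathsf E_j}$ is dense in $\mathbb R^{2N}$. -/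

import Mathlib

noncomputable section

namespace GaussianIC

open MeasureTheory Matrix
open scoped ComplexOrder InnerProductSpace Kronecker

/-! ### Trace and states on a complex Hilbert space -/

section Hilbert

variable {H : Type*} [NormedAddCommGroup H] [InnerProductSpace ℂ H] [CompleteSpace H]

variable (H) in
/-- The index set of a fixed orthonormal (Hilbert) basis of `H`. -/
def basisSet : Set H := (exists_hilbertBasis ℂ H).choose

variable (H) in
/-- A fixed orthonormal (Hilbert) basis of `H`. -/
def basis : HilbertBasis (basisSet H) ℂ H := (exists_hilbertBasis ℂ H).choose_spec.choose

/-- The trace `tr T = ∑ᵢ ⟨eᵢ, T eᵢ⟩`. For a trace class operator `T` the series converges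
absolutely and its sum does not depend on the orthonormal basis. -/
def trace (T : H →L[ℂ] H) : ℂ := ∑' i, ⟪basis H i, T (basis H i)⟫_ℂ

/-- States (density operators): positive operators of trace one. The series of the trace of a
positive operator has nonnegative terms, and its convergence says that the operator is trace
class. -/
structure IsState (ρ : H →L[ℂ] H) : Prop where
  isPositive : ρ.IsPositive
  hasSum_one : HasSum (fun i => ⟪basis H i, ρ (basis H i)⟫_ℂ) 1

end Hilbert

/-! ### Observables with values in `ℝ^M` -/

/-- An observable (normalized positive operator valued measure) on the Borel sets of `ℝ^M`,
countably additive in the weak operator topology. Only the values on Borel sets matter. -/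
structure Observable (H : Type*) [NormedAddCommGroup H] [InnerProductSpace ℂ H]
    [CompleteSpace H] (M : ℕ) where
  toFun : Set (EuclideanSpace ℝ (Fin M)) → H →L[ℂ] H
  isPositive : ∀ X, MeasurableSet X → (toFun X).IsPositive
  map_univ : toFun Set.univ = 1
  hasSum_iUnion : ∀ X : ℕ → Set (EuclideanSpace ℝ (Fin M)), (∀ n, MeasurableSet (X n)) →
    Pairwise (Function.onFun Disjoint X) →
    ∀ φ ψ : H, HasSum (fun n => ⟪φ, toFun (X n) ψ⟫_ℂ) ⟪φ, toFun (⋃ n, X n) ψ⟫_ℂ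

section Obs

variable {H : Type*} [NormedAddCommGroup H] [InnerProductSpace ℂ H] [CompleteSpace H] {M : ℕ}

theorem Observable.hasSum_re (E : Observable H M) (ψ : H)
    ⦃X : ℕ → Set (EuclideanSpace ℝ (Fin M))⦄ (hX : ∀ n, MeasurableSet (X n))
    (hd : Pairwise (Function.onFun Disjoint X)) :
    HasSum (fun n => (⟪ψ, E.toFun (X n) ψ⟫_ℂ).re) (⟪ψ, E.toFun (⋃ n, X n) ψ⟫_ℂ).re :=
  Complex.hasSum_re (E.hasSum_iUnion X hX hd ψ ψ)

theorem Observable.re_inner_nonneg (E : Observable H M) (ψ : H)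
    {X : Set (EuclideanSpace ℝ (Fin M))} (hX : MeasurableSet X) :
    0 ≤ (⟪ψ, E.toFun X ψ⟫_ℂ).re :=
  (E.isPositive X hX).re_inner_nonneg_right ψ

theorem Observable.re_inner_empty (E : Observable H M) (ψ : H) :
    (⟪ψ, E.toFun ∅ ψ⟫_ℂ).re = 0 := by
  have h := E.hasSum_re ψ (X := fun _ => ∅) (fun _ => MeasurableSet.empty)
    (fun _ _ _ => disjoint_bot_left)
  exact (summable_const_iff _).1 h.summable

/-- The finite positive Borel measure `X ↦ ⟨ψ, E(X) ψ⟩` on `ℝ^M`. -/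
def Observable.scalarMeasure (E : Observable H M) (ψ : H) :
    Measure (EuclideanSpace ℝ (Fin M)) :=
  Measure.ofMeasurable (fun X _ => ENNReal.ofReal (⟪ψ, E.toFun X ψ⟫_ℂ).re)
    (by rw [E.re_inner_empty ψ, ENNReal.ofReal_zero])
    (fun X hX hd => by
      rw [← (E.hasSum_re ψ hX hd).tsum_eq]
      exact ENNReal.ofReal_tsum_of_nonneg (fun n => E.re_inner_nonneg ψ (hX n))
        (E.hasSum_re ψ hX hd).summable)

/-- `T = ∫ exp(i pᵀx) E(dx)`, the value at `p` of the characteristic function of `E`, as a weak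
integral. The diagonal matrix elements determine `T` by polarization. -/
def Observable.HasCharFunAt (E : Observable H M) (p : EuclideanSpace ℝ (Fin M))
    (T : H →L[ℂ] H) : Prop :=
  ∀ ψ : H, ∫ x, Complex.exp (Complex.I * ((p ⬝ᵥ x : ℝ) : ℂ)) ∂(E.scalarMeasure ψ) = ⟪ψ, T ψ⟫_ℂ

/-- The outcome distribution `X ↦ tr(ρ E(X))` of a measurement of `E` in the state `ρ`. -/
def Observable.outcome (E : Observable H M) (ρ : H →L[ℂ] H)
    (X : Set (EuclideanSpace ℝ (Fin M))) : ℂ :=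
  trace (ρ * E.toFun X)

/-- A family of observables is informationally complete if every state is determined by the
outcome distributions of all observables of the family. -/
def InformationallyComplete {ι : Type*} {m : ι → ℕ} (E : (j : ι) → Observable H (m j)) : Prop :=
  ∀ ρ σ : H →L[ℂ] H, IsState ρ → IsState σ →
    (∀ j, ∀ X, MeasurableSet X → (E j).outcome ρ X = (E j).outcome σ X) → ρ = σ

end Obs

/-! ### The `N`-mode system in the coordinate representation -/

/-- The Hilbert space `L²(ℝ^N)` of `N` modes. -/
abbrev ModeSpace (N : ℕ) : Type := Lp ℂ 2 (volume : Measure (EuclideanSpace ℝ (Fin N)))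

/-- The phase space `ℝ^{2N}`, with coordinates `(q₁, p₁, …, q_N, p_N)`: `x (j, 0)` is the `j`-th
position and `x (j, 1)` the `j`-th momentum. -/
abbrev PhaseSpace (N : ℕ) : Type := EuclideanSpace ℝ (Fin N × Fin 2)

/-- The position part `q` of a phase space point. -/
def PhaseSpace.pos {N : ℕ} (x : PhaseSpace N) : EuclideanSpace ℝ (Fin N) :=
  WithLp.toLp 2 fun j => x (j, 0)

/-- The momentum part `p` of a phase space point. -/
def PhaseSpace.mom {N : ℕ} (x : PhaseSpace N) : EuclideanSpace ℝ (Fin N) :=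
  WithLp.toLp 2 fun j => x (j, 1)

/-- The symplectic matrix `Ω`, the direct sum of `N` blocks `!![0, 1; -1, 0]`. -/
def symplecticForm (N : ℕ) : Matrix (Fin N × Fin 2) (Fin N × Fin 2) ℝ :=
  (1 : Matrix (Fin N) (Fin N) ℝ) ⊗ₖ !![0, 1; -1, 0]

/-- The function `t ↦ exp(i (p·t - p·q/2)) ψ(t - q)`. -/
def weylFun {N : ℕ} (x : PhaseSpace N) (ψ : EuclideanSpace ℝ (Fin N) → ℂ)
    (t : EuclideanSpace ℝ (Fin N)) : ℂ :=
  Complex.exp (Complex.I * ((x.mom ⬝ᵥ t - (x.mom ⬝ᵥ x.pos) / 2 : ℝ) : ℂ)) * ψ (t - x.pos)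

theorem norm_weylFun {N : ℕ} (x : PhaseSpace N) (ψ : EuclideanSpace ℝ (Fin N) → ℂ)
    (t : EuclideanSpace ℝ (Fin N)) : ‖weylFun x ψ t‖ = ‖ψ (t - x.pos)‖ := by
  rw [weylFun, norm_mul, mul_comm Complex.I, Complex.norm_exp_ofReal_mul_I, one_mul]

theorem weylFun_aestronglyMeasurable {N : ℕ} (x : PhaseSpace N)
    {ψ : EuclideanSpace ℝ (Fin N) → ℂ} (hψ : AEStronglyMeasurable ψ volume) :
    AEStronglyMeasurable (weylFun x ψ) volume := by
  refine AEStronglyMeasurable.mul (Continuous.aestronglyMeasurable ?_)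
    (hψ.comp_measurePreserving (measurePreserving_sub_right volume x.pos))
  simp only [dotProduct]
  fun_prop

theorem eLpNorm_weylFun {N : ℕ} (x : PhaseSpace N) {ψ : EuclideanSpace ℝ (Fin N) → ℂ}
    (hψ : AEStronglyMeasurable ψ volume) :
    eLpNorm (weylFun x ψ) 2 volume = eLpNorm ψ 2 volume := by
  rw [← eLpNorm_comp_measurePreserving hψ (measurePreserving_sub_right volume x.pos)]
  exact eLpNorm_congr_norm_ae (Filter.Eventually.of_forall fun t => norm_weylFun x ψ t)

theorem memLp_weylFun {N : ℕ} (x : PhaseSpace N) (ψ : ModeSpace N) :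
    MemLp (weylFun x ψ) 2 volume :=
  ⟨weylFun_aestronglyMeasurable x (Lp.aestronglyMeasurable ψ), by
    rw [eLpNorm_weylFun x (Lp.aestronglyMeasurable ψ)]; exact Lp.eLpNorm_lt_top ψ⟩

theorem weylFun_congr {N : ℕ} (x : PhaseSpace N) {ψ φ : EuclideanSpace ℝ (Fin N) → ℂ}
    (h : ψ =ᵐ[volume] φ) : weylFun x ψ =ᵐ[volume] weylFun x φ := by
  have h' := (measurePreserving_sub_right volume x.pos).quasiMeasurePreserving.ae h
  filter_upwards [h'] with t ht
  simp only [weylFun, ht]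

/-- The Weyl operator `W(x) = exp(-i xᵀ Ω R)`, `x = (q, p)`, on `L²(ℝ^N)`. Since
`-i xᵀ Ω R = i (p·Q - q·P)`, where `Q_j` multiplies by `t_j` and `P_j = -i ∂_j`, it is
`(W(x) ψ)(t) = exp(i (p·t - p·q/2)) ψ(t - q)`. -/
def weyl {N : ℕ} (x : PhaseSpace N) : ModeSpace N →L[ℂ] ModeSpace N :=
  LinearIsometry.toContinuousLinearMap
    { toFun := fun ψ => (memLp_weylFun x ψ).toLp (weylFun x ψ)
      map_add' := fun ψ φ => by
        rw [← MemLp.toLp_add]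
        refine MemLp.toLp_congr _ _ ((weylFun_congr x (Lp.coeFn_add ψ φ)).trans ?_)
        exact Filter.Eventually.of_forall fun t => by
          simp only [weylFun, Pi.add_apply]; ring
      map_smul' := fun c ψ => by
        rw [RingHom.id_apply, ← MemLp.toLp_const_smul]
        refine MemLp.toLp_congr _ _ ((weylFun_congr x (Lp.coeFn_smul c ψ)).trans ?_)
        exact Filter.Eventually.of_forall fun t => by
          simp only [weylFun, Pi.smul_apply, smul_eq_mul]; ring
      norm_map' := fun ψ => by
        change ‖(memLp_weylFun x ψ).toLp (weylFun x ψ)‖ = ‖ψ‖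
        rw [Lp.norm_toLp, Lp.norm_def, eLpNorm_weylFun x (Lp.aestronglyMeasurable ψ)] }

/-- `E` is a Gaussian observable with parameters `(A, B, v)`: the matrix `B - i Aᵀ Ω A` is
positive semidefinite and the characteristic function of `E` is
`p ↦ exp(-pᵀ B p / 4 - i vᵀ p) W(A p)`. -/
structure IsGaussian {N M : ℕ} (E : Observable (ModeSpace N) M)
    (A : Matrix (Fin N × Fin 2) (Fin M) ℝ) (B : Matrix (Fin M) (Fin M) ℝ)
    (v : EuclideanSpace ℝ (Fin M)) : Prop where
  posSemidef : (B.map Complex.ofReal -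
    Complex.I • (Aᵀ * symplecticForm N * A).map Complex.ofReal).PosSemidef
  hasCharFunAt : ∀ p : EuclideanSpace ℝ (Fin M), E.HasCharFunAt p
    (Complex.exp (-(1 / 4) * ((p ⬝ᵥ (B *ᵥ p) : ℝ) : ℂ) - Complex.I * ((v ⬝ᵥ p : ℝ) : ℂ)) •
      weyl (toEuclideanLin A p))

/-- The subspace `X_E = {A p | p ∈ ℝ^M}` of the phase space. -/
def subspaceOf {N M : ℕ} (A : Matrix (Fin N × Fin 2) (Fin M) ℝ) : Submodule ℝ (PhaseSpace N) :=
  LinearMap.range (toEuclideanLin A)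

end GaussianIC

end

namespace GaussianIC

open MeasureTheory Matrix
open scoped ComplexOrder InnerProductSpace Kronecker

/-! ### The trace against a state -/

section Trace

variable {H : Type*} [NormedAddCommGroup H] [InnerProductSpace ℂ H]

/-! An outcome distribution is a finite measure, hence determined by its characteristic function,
which for a Gaussian observable is a nowhere vanishing factor times `tr(ρ W(A p))`. So a measurement
reveals exactly the restriction to `X_E` of the function `x ↦ tr(ρ W(x))`
(`IsGaussian.outcome_eq_iff`), and the question is which unions of subspaces determine this
function.

If the union is dense, continuity (`IsState.continuous_trace_weyl`) extends agreement to all of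
phase space, and the full function determines the state (`IsState.ext_of_trace_weyl`): at fixed `q`
it is, up to phase and scaling in `p`, the Fourier transform of a displaced diagonal of the kernel
of `ρ`, so Fourier inversion recovers matrix elements between Schwartz functions.

If the union is not dense, it misses a nonempty open set `U` without `0`. Mixing the displaced
vectors `W(x)ψ` with a probability density `f` multiplies `⟨ψ, W(z)ψ⟩` by the Fourier transform of
`f`, by the commutation relations. Two densities whose transforms differ only inside `U ∪ -U`
(`exists_densities_fourier_eq_off`) then give distinct states that no observable of the family
separates. -/

theorem hasSum_norm_inner_sq {κ : Type*} (b : HilbertBasis κ ℂ H) (u : H) :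
    HasSum (fun i => ‖⟪b i, u⟫_ℂ‖ ^ 2) (‖u‖ ^ 2) := by
  have h := Complex.hasSum_re (b.hasSum_inner_mul_inner u u)
  rw [inner_self_eq_norm_sq_to_K] at h
  convert h using 1
  · ext i
    rw [← inner_conj_symm u, mul_comm, Complex.mul_conj, Complex.ofReal_re,
      Complex.normSq_eq_norm_sq]
  · norm_cast

theorem summable_inner_map {κ : Type*} {ψ : κ → H} (hψ : Summable fun i => ‖ψ i‖ ^ 2)
    (T : H →L[ℂ] H) : Summable fun i => ⟪ψ i, T (ψ i)⟫_ℂ := by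
  refine Summable.of_norm_bounded (hψ.mul_left ‖T‖) fun i => ?_
  calc ‖⟪ψ i, T (ψ i)⟫_ℂ‖ ≤ ‖ψ i‖ * ‖T (ψ i)‖ := norm_inner_le_norm _ _
    _ ≤ ‖ψ i‖ * (‖T‖ * ‖ψ i‖) := by gcongr; exact T.le_opNorm _
    _ = ‖T‖ * ‖ψ i‖ ^ 2 := by ring

variable [CompleteSpace H]

/-- Distinct basis vectors are at distance `√2`, so the balls of radius `1/2` around them are
disjoint. Countability is what later permits exchanging sums over the basis with integrals. -/
theorem countable_basisSet [TopologicalSpace.SeparableSpace H] : Countable (basisSet H) := by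
  refine Pairwise.countable_of_isOpen_disjoint (s := fun i => Metric.ball (basis H i) (1 / 2))
    (fun i j hij => ?_) (fun i => Metric.isOpen_ball) (fun i => ⟨basis H i, by simp⟩)
  refine Metric.ball_disjoint_ball ?_
  have h := (basis H).orthonormal
  have h2 : ‖basis H i - basis H j‖ ^ 2 = 2 := by
    rw [@norm_sub_sq ℂ, h.1 i, h.1 j, h.2 hij]; norm_num
  rw [dist_eq_norm]
  nlinarith [norm_nonneg (basis H i - basis H j)]

/-- Cyclicity of the trace, `tr (S (S T)) = tr (S T S)`, for a selfadjoint Hilbert-Schmidt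
operator `S`. -/
theorem tsum_inner_map_comm {κ : Type*} (b : HilbertBasis κ ℂ H) {S : H →L[ℂ] H}
    (hS : ∀ u v, ⟪S u, v⟫_ℂ = ⟪u, S v⟫_ℂ) (hsum : Summable fun i => ‖S (b i)‖ ^ 2)
    (T : H →L[ℂ] H) :
    ∑' i, ⟪S (b i), S (T (b i))⟫_ℂ = ∑' i, ⟪S (b i), T (S (b i))⟫_ℂ := by
  set Td := ContinuousLinearMap.adjoint T with hTd
  -- Both sides are iterated sums of one double series. It converges absolutely because `S` and `Td
  -- * S` are Hilbert-Schmidt.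
  have hrow : ∀ i, HasSum (fun j => ⟪b i, S (b j)⟫_ℂ * ⟪Td (S (b j)), b i⟫_ℂ)
      ⟪S (b i), S (T (b i))⟫_ℂ := fun i => by
    have h := b.hasSum_inner_mul_inner (S (b i)) (S (T (b i)))
    have he : ∀ j, ⟪S (b i), b j⟫_ℂ * ⟪b j, S (T (b i))⟫_ℂ =
        ⟪b i, S (b j)⟫_ℂ * ⟪Td (S (b j)), b i⟫_ℂ := fun j => by
      rw [hS (b i), ← hS (b j), hTd, ContinuousLinearMap.adjoint_inner_left]
    simpa only [he] using h
  have hcol : ∀ j, HasSum (fun i => ⟪b i, S (b j)⟫_ℂ * ⟪Td (S (b j)), b i⟫_ℂ)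
      ⟪S (b j), T (S (b j))⟫_ℂ := fun j => by
    have h := b.hasSum_inner_mul_inner (Td (S (b j))) (S (b j))
    rw [hTd, ContinuousLinearMap.adjoint_inner_left, ← hTd] at h
    simpa only [mul_comm] using h
  have hsq : ∀ (R : H →L[ℂ] H),
      Summable fun x : κ × κ => ‖⟪b x.2, R (S (b x.1))⟫_ℂ‖ ^ 2 := fun R => by
    rw [summable_prod_of_nonneg (fun x => sq_nonneg _)]
    refine ⟨fun j => (hasSum_norm_inner_sq b (R (S (b j)))).summable, ?_⟩
    simp only [fun j => (hasSum_norm_inner_sq b (R (S (b j)))).tsum_eq]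
    refine Summable.of_nonneg_of_le (fun _ => by positivity) (fun j => ?_)
      (hsum.mul_left (‖R‖ ^ 2))
    rw [← mul_pow]
    gcongr
    exact R.le_opNorm _
  have hprod : Summable (Function.uncurry fun j i => ⟪b i, S (b j)⟫_ℂ * ⟪Td (S (b j)), b i⟫_ℂ) := by
    refine Summable.of_norm_bounded ((hsq 1).add (hsq Td)) fun x => ?_
    simp only [Function.uncurry, norm_mul, one_apply_eq_self]
    rw [norm_inner_symm (Td _)]
    nlinarith [sq_nonneg (‖⟪b x.2, S (b x.1)⟫_ℂ‖ - ‖⟪b x.2, Td (S (b x.1))⟫_ℂ‖),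
      sq_nonneg (‖⟪b x.2, S (b x.1)⟫_ℂ‖), sq_nonneg ‖⟪b x.2, Td (S (b x.1))⟫_ℂ‖]
  simp only [fun i => (hrow i).tsum_eq.symm, fun j => (hcol j).tsum_eq.symm]
  exact hprod.tsum_comm

/-- A state is a mixture `∑ᵢ |ψᵢ⟩⟨ψᵢ|` of (unnormalized) vectors. -/
theorem IsState.exists_mixture {ρ : H →L[ℂ] H} (hρ : IsState ρ) :
    ∃ ψ : basisSet H → H, HasSum (fun i => ‖ψ i‖ ^ 2) 1 ∧
      (∀ T : H →L[ℂ] H, trace (ρ * T) = ∑' i, ⟪ψ i, T (ψ i)⟫_ℂ) ∧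
      ∀ u v, ⟪u, ρ v⟫_ℂ = ∑' i, ⟪u, ψ i⟫_ℂ * ⟪ψ i, v⟫_ℂ := by
  have hnn : 0 ≤ ρ := (ContinuousLinearMap.nonneg_iff_isPositive ρ).2 hρ.isPositive
  -- The mixture consists of the vectors `√ρ eᵢ`; trace one says that their squared norms sum to
  -- one.
  set S := CFC.sqrt ρ
  have hSS : S * S = ρ := CFC.sqrt_mul_sqrt_self ρ hnn
  have hsa : IsSelfAdjoint S := IsSelfAdjoint.of_nonneg (CFC.sqrt_nonneg ρ)
  have hS : ∀ u v, ⟪S u, v⟫_ℂ = ⟪u, S v⟫_ℂ := fun u v => hsa.isSymmetric u v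
  have hρS : ∀ v, ρ v = S (S v) := fun v => by rw [← hSS]; rfl
  have hsum : HasSum (fun i => ‖S (basis H i)‖ ^ 2) 1 := by
    have h := Complex.hasSum_re hρ.hasSum_one
    rw [Complex.one_re] at h
    convert h using 2 with i
    rw [hρS, ← hS, inner_self_eq_norm_sq_to_K]
    norm_cast
  refine ⟨fun i => S (basis H i), hsum, fun T => ?_, fun u v => ?_⟩
  · rw [← tsum_inner_map_comm (basis H) hS hsum.summable T, trace]
    refine tsum_congr fun i => ?_
    rw [mul_apply_eq_comp, hρS, hS]
  · rw [hρS, ← hS, ← (basis H).tsum_inner_mul_inner]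
    refine tsum_congr fun i => ?_
    rw [hS, hS]

end Trace

/-! ### Outcome distributions and their characteristic functions -/

section OutcomeMeasure

variable {H : Type*} [NormedAddCommGroup H] [InnerProductSpace ℂ H] [CompleteSpace H] {M : ℕ}
  {κ : Type*} {ψ : κ → H}

theorem Observable.scalarMeasure_apply (E : Observable H M) (ψ : H)
    {X : Set (EuclideanSpace ℝ (Fin M))} (hX : MeasurableSet X) :
    E.scalarMeasure ψ X = ENNReal.ofReal (⟪ψ, E.toFun X ψ⟫_ℂ).re :=
  Measure.ofMeasurable_apply X hX

theorem Observable.ofReal_re_inner (E : Observable H M) (ψ : H)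
    {X : Set (EuclideanSpace ℝ (Fin M))} (hX : MeasurableSet X) :
    (((⟪ψ, E.toFun X ψ⟫_ℂ).re : ℝ) : ℂ) = ⟪ψ, E.toFun X ψ⟫_ℂ :=
  (Complex.eq_re_of_ofReal_le ((E.isPositive X hX).inner_nonneg_right ψ)).symm

/-- The outcome distribution in the mixture `∑ᵢ |ψᵢ⟩⟨ψᵢ|`. -/
noncomputable def Observable.mixtureMeasure (E : Observable H M) (ψ : κ → H) :
    Measure (EuclideanSpace ℝ (Fin M)) :=
  Measure.sum fun i => E.scalarMeasure (ψ i)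

theorem Observable.mixtureMeasure_apply (E : Observable H M) (hψ : Summable fun i => ‖ψ i‖ ^ 2)
    {X : Set (EuclideanSpace ℝ (Fin M))} (hX : MeasurableSet X) :
    E.mixtureMeasure ψ X = ENNReal.ofReal (∑' i, (⟪ψ i, E.toFun X (ψ i)⟫_ℂ).re) := by
  rw [mixtureMeasure, Measure.sum_apply _ hX,
    ENNReal.ofReal_tsum_of_nonneg (fun i => E.re_inner_nonneg (ψ i) hX)
      (Complex.hasSum_re (summable_inner_map hψ (E.toFun X)).hasSum).summable]
  exact tsum_congr fun i => E.scalarMeasure_apply (ψ i) hX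

theorem Observable.mixtureMeasure_real (E : Observable H M) (hψ : Summable fun i => ‖ψ i‖ ^ 2)
    {X : Set (EuclideanSpace ℝ (Fin M))} (hX : MeasurableSet X) :
    (((E.mixtureMeasure ψ).real X : ℝ) : ℂ) = ∑' i, ⟪ψ i, E.toFun X (ψ i)⟫_ℂ := by
  rw [measureReal_def, E.mixtureMeasure_apply hψ hX,
    ENNReal.toReal_ofReal (tsum_nonneg fun i => E.re_inner_nonneg (ψ i) hX), Complex.ofReal_tsum]
  exact tsum_congr fun i => E.ofReal_re_inner (ψ i) hX

theorem Observable.isFiniteMeasure_mixtureMeasure (E : Observable H M)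
    (hψ : Summable fun i => ‖ψ i‖ ^ 2) : IsFiniteMeasure (E.mixtureMeasure ψ) :=
  ⟨by rw [E.mixtureMeasure_apply hψ MeasurableSet.univ]; exact ENNReal.ofReal_lt_top⟩

/-- The weak integral gives the formula for each `ψ i`; a bounded integrand against a finite sum
measure may be integrated term by term. -/
theorem Observable.charFun_mixtureMeasure (E : Observable H M)
    (hψ : Summable fun i => ‖ψ i‖ ^ 2) {p : EuclideanSpace ℝ (Fin M)} {T : H →L[ℂ] H}
    (hT : E.HasCharFunAt p T) :
    charFun (E.mixtureMeasure ψ) p = ∑' i, ⟪ψ i, T (ψ i)⟫_ℂ := by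
  have := E.isFiniteMeasure_mixtureMeasure hψ
  have he : ∀ x : EuclideanSpace ℝ (Fin M), Complex.exp (⟪x, p⟫_ℝ * Complex.I) =
      Complex.exp (Complex.I * ((p ⬝ᵥ x : ℝ) : ℂ)) := fun x => by
    rw [mul_comm, EuclideanSpace.inner_eq_star_dotProduct]; simp
  have hint : Integrable (fun x : EuclideanSpace ℝ (Fin M) => Complex.exp (⟪x, p⟫_ℝ * Complex.I))
      (Measure.sum fun i => E.scalarMeasure (ψ i)) := by
    change Integrable _ (E.mixtureMeasure ψ)
    refine Integrable.of_bound (C := 1) (Continuous.aestronglyMeasurable (by fun_prop)) ?_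
    exact Filter.Eventually.of_forall fun x => by rw [Complex.norm_exp_ofReal_mul_I]
  rw [charFun_apply, mixtureMeasure, integral_sum_measure hint]
  refine tsum_congr fun i => ?_
  simp only [he]
  exact hT (ψ i)

/-- Two states have the same outcome distributions iff their expectations of the values of the
characteristic function of the observable agree. -/
theorem Observable.outcome_eq_iff (E : Observable H M)
    {T : EuclideanSpace ℝ (Fin M) → H →L[ℂ] H} (hT : ∀ p, E.HasCharFunAt p (T p))
    {ρ σ : H →L[ℂ] H} (hρ : IsState ρ) (hσ : IsState σ) :
    (∀ X, MeasurableSet X → E.outcome ρ X = E.outcome σ X) ↔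
      ∀ p, trace (ρ * T p) = trace (σ * T p) := by
  obtain ⟨ψ, hψ, htψ, -⟩ := hρ.exists_mixture
  obtain ⟨φ, hφ, htφ, -⟩ := hσ.exists_mixture
  have := E.isFiniteMeasure_mixtureMeasure hψ.summable
  have := E.isFiniteMeasure_mixtureMeasure hφ.summable
  simp only [Observable.outcome, htψ, htφ, ← E.charFun_mixtureMeasure hψ.summable (hT _),
    ← E.charFun_mixtureMeasure hφ.summable (hT _)]
  refine ⟨fun h p => ?_, fun h X hX => ?_⟩
  · have heq : E.mixtureMeasure ψ = E.mixtureMeasure φ := by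
      refine Measure.ext fun X hX => ?_
      rw [← measureReal_eq_measureReal_iff]
      have := h X hX
      rw [← E.mixtureMeasure_real hψ.summable hX, ← E.mixtureMeasure_real hφ.summable hX] at this
      exact_mod_cast this
    rw [heq]
  · rw [← E.mixtureMeasure_real hψ.summable hX, ← E.mixtureMeasure_real hφ.summable hX,
      Measure.ext_of_charFun (funext h)]

end OutcomeMeasure

theorem trace_mul_smul {H : Type*} [NormedAddCommGroup H] [InnerProductSpace ℂ H]
    [CompleteSpace H] (ρ T : H →L[ℂ] H) (c : ℂ) : trace (ρ * (c • T)) = c * trace (ρ * T) := by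
  simp only [trace, mul_smul_comm, _root_.smul_apply, inner_smul_right, tsum_mul_left]

/-- The exponential prefactor never vanishes and cancels, so `B` and `v` have no influence. -/
theorem IsGaussian.outcome_eq_iff {N M : ℕ} {E : Observable (ModeSpace N) M}
    {A : Matrix (Fin N × Fin 2) (Fin M) ℝ} {B : Matrix (Fin M) (Fin M) ℝ}
    {v : EuclideanSpace ℝ (Fin M)} (hE : IsGaussian E A B v)
    {ρ σ : ModeSpace N →L[ℂ] ModeSpace N} (hρ : IsState ρ) (hσ : IsState σ) :
    (∀ X, MeasurableSet X → E.outcome ρ X = E.outcome σ X) ↔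
      ∀ x ∈ subspaceOf A, trace (ρ * weyl x) = trace (σ * weyl x) := by
  rw [E.outcome_eq_iff hE.hasCharFunAt hρ hσ]
  simp only [trace_mul_smul, mul_right_inj' (Complex.exp_ne_zero _), subspaceOf,
    LinearMap.mem_range, forall_exists_index, forall_apply_eq_imp_iff]

/-! ### Weyl operators -/

/-- For constant norm, `‖F y - F x‖² = 2r² - 2 Re ⟪F x, F y⟫`. -/
theorem continuous_of_continuous_inner {X H : Type*} [TopologicalSpace X] [NormedAddCommGroup H]
    [InnerProductSpace ℂ H] {F : X → H} {r : ℝ} (hr : ∀ x, ‖F x‖ = r)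
    (hF : ∀ x, Continuous fun y => ⟪F x, F y⟫_ℂ) : Continuous F := by
  refine continuous_iff_continuousAt.2 fun x => ?_
  rw [ContinuousAt, tendsto_iff_norm_sub_tendsto_zero]
  have he : ∀ y, ‖F y - F x‖ = √(2 * r ^ 2 - 2 * (⟪F x, F y⟫_ℂ).re) := fun y => by
    rw [eq_comm, Real.sqrt_eq_iff_eq_sq _ (norm_nonneg _), norm_sub_rev, @norm_sub_sq ℂ, hr, hr,
      RCLike.re_eq_complex_re]
    · ring
    · have := (Complex.re_le_norm _).trans (norm_inner_le_norm (𝕜 := ℂ) (F x) (F y))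
      rw [hr, hr] at this
      linarith [sq r]
  simp only [he]
  have hc : Continuous fun y => √(2 * r ^ 2 - 2 * (⟪F x, F y⟫_ℂ).re) := by
    have := hF x
    fun_prop
  have h := hc.tendsto x
  have h0 : (⟪F x, F x⟫_ℂ).re = r ^ 2 := by
    rw [← hr x, inner_self_eq_norm_sq_to_K]; norm_cast
  rwa [h0, sub_self, Real.sqrt_zero] at h

section Weyl

open scoped SchwartzMap

variable {N : ℕ}

theorem coeFn_weyl (x : PhaseSpace N) (ψ : ModeSpace N) : weyl x ψ =ᵐ[volume] weylFun x ψ :=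
  (memLp_weylFun x ψ).coeFn_toLp

theorem norm_weyl (x : PhaseSpace N) (ψ : ModeSpace N) : ‖weyl x ψ‖ = ‖ψ‖ := by
  rw [weyl, LinearIsometry.coe_toContinuousLinearMap, LinearIsometry.norm_map]

theorem inner_weyl_weyl (x : PhaseSpace N) (ψ φ : ModeSpace N) :
    ⟪weyl x ψ, weyl x φ⟫_ℂ = ⟪ψ, φ⟫_ℂ := by
  rw [weyl, LinearIsometry.coe_toContinuousLinearMap, LinearIsometry.inner_map_map]

@[fun_prop]
theorem continuous_pos : Continuous (PhaseSpace.pos (N := N)) := by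
  unfold PhaseSpace.pos; fun_prop

@[fun_prop]
theorem continuous_mom : Continuous (PhaseSpace.mom (N := N)) := by
  unfold PhaseSpace.mom; fun_prop

theorem denseRange_schwartz_toLp :
    DenseRange fun g : 𝓢(EuclideanSpace ℝ (Fin N), ℂ) => (g.toLp 2 : ModeSpace N) :=
  SchwartzMap.denseRange_toLpCLM ENNReal.ofNat_ne_top

theorem exists_norm_schwartz_le (g : 𝓢(EuclideanSpace ℝ (Fin N), ℂ)) : ∃ C, ∀ t, ‖g t‖ ≤ C :=
  ⟨_, fun t => g.toBoundedContinuousFunction.norm_coe_le_norm t⟩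

/-- Schwartz functions are continuous, bounded and integrable, so the integrand is continuous in `y`
at each `t` and dominated uniformly in `y`. -/
theorem continuous_inner_weyl_schwartz (x : PhaseSpace N) (g : 𝓢(EuclideanSpace ℝ (Fin N), ℂ)) :
    Continuous fun y => ⟪weyl x (g.toLp 2), weyl y (g.toLp 2)⟫_ℂ := by
  obtain ⟨C, hC⟩ := exists_norm_schwartz_le g
  have hae : ∀ y, weyl y (g.toLp 2) =ᵐ[volume] weylFun y g := fun y =>
    (coeFn_weyl y _).trans (weylFun_congr y (g.coeFn_toLp 2 volume))
  have he : ∀ y, ⟪weyl x (g.toLp 2), weyl y (g.toLp 2)⟫_ℂ =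
      ∫ t, ⟪weylFun x g t, weylFun y g t⟫_ℂ := fun y => by
    rw [L2.inner_def]
    refine integral_congr_ae ?_
    filter_upwards [hae x, hae y] with t h1 h2
    rw [h1, h2]
  simp only [he]
  have hcont : ∀ y, Continuous (weylFun y g) := fun y => by
    unfold weylFun; simp only [dotProduct]; fun_prop
  refine continuous_of_dominated (bound := fun t => ‖g (t - x.pos)‖ * C)
    (fun y => ((hcont x).inner (hcont y)).aestronglyMeasurable)
    (fun y => Filter.Eventually.of_forall fun t => ?_) ?_ (Filter.Eventually.of_forall fun t => ?_)
  · refine (norm_inner_le_norm _ _).trans ?_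
    rw [norm_weylFun, norm_weylFun]
    gcongr
    exact hC _
  · exact (g.integrable.comp_sub_right x.pos).norm.mul_const C
  · refine Continuous.inner continuous_const ?_
    unfold weylFun; simp only [dotProduct]; fun_prop

/-- Strong continuity of the Weyl operators. -/
theorem continuous_weyl (ψ : ModeSpace N) : Continuous fun x : PhaseSpace N => weyl x ψ := by
  -- Weyl operators are isometries, so Schwartz approximation of `ψ` is uniform in `x`.
  refine continuous_of_uniform_approx_of_continuous fun u hu => ?_
  obtain ⟨ε, hε, hεu⟩ := Metric.mem_uniformity_dist.1 hu
  obtain ⟨g, hg⟩ := denseRange_schwartz_toLp.exists_dist_lt ψ hε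
  refine ⟨fun x => weyl x (g.toLp 2), ?_, fun x => hεu ?_⟩
  · exact continuous_of_continuous_inner (fun x => norm_weyl x _)
      fun x => continuous_inner_weyl_schwartz x g
  · rw [dist_eq_norm, ← map_sub, norm_weyl, ← dist_eq_norm]
    exact hg

/-- The canonical commutation relations in Weyl form. -/
theorem weyl_weyl_comm (z x : PhaseSpace N) (ψ : ModeSpace N) :
    weyl z (weyl x ψ) =
      Complex.exp (Complex.I * ((z.mom ⬝ᵥ x.pos - x.mom ⬝ᵥ z.pos : ℝ) : ℂ)) •
        weyl x (weyl z ψ) := by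
  refine Lp.ext ?_
  have h : ∀ z x : PhaseSpace N, weyl z (weyl x ψ) =ᵐ[volume] weylFun z (weylFun x ψ) :=
    fun z x => (coeFn_weyl z _).trans (weylFun_congr z (coeFn_weyl x ψ))
  refine (h z x).trans (Filter.EventuallyEq.trans ?_ (Lp.coeFn_smul _ _).symm)
  filter_upwards [h x z] with t ht
  rw [Pi.smul_apply, ht]
  simp only [weylFun, smul_eq_mul, ← mul_assoc, ← Complex.exp_add]
  rw [sub_right_comm]
  congr 2
  rw [WithLp.ofLp_sub, WithLp.ofLp_sub, dotProduct_sub, dotProduct_sub]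
  push_cast
  ring

theorem inner_weyl_conj (z x : PhaseSpace N) (ψ : ModeSpace N) :
    ⟪weyl x ψ, weyl z (weyl x ψ)⟫_ℂ =
      Complex.exp (Complex.I * ((z.mom ⬝ᵥ x.pos - x.mom ⬝ᵥ z.pos : ℝ) : ℂ)) *
        ⟪ψ, weyl z ψ⟫_ℂ := by
  rw [weyl_weyl_comm, inner_smul_right, inner_weyl_weyl]

/-- The characteristic function `x ↦ tr (ρ W(x))` of a state is continuous. -/
theorem IsState.continuous_trace_weyl {ρ : ModeSpace N →L[ℂ] ModeSpace N} (hρ : IsState ρ) :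
    Continuous fun x => trace (ρ * weyl x) := by
  obtain ⟨ψ, hψ, ht, -⟩ := hρ.exists_mixture
  simp only [ht]
  refine continuous_tsum (fun i => continuous_const.inner (continuous_weyl (ψ i))) hψ.summable
    fun i x => (norm_inner_le_norm _ _).trans ?_
  rw [norm_weyl, sq]

end Weyl

/-! ### A state is determined by its characteristic function -/

section Reconstruction

open scoped SchwartzMap FourierTransform Convolution

variable {N : ℕ}

/-- The phase space point with position `q` and momentum `p`. -/
noncomputable def phasePoint (q p : EuclideanSpace ℝ (Fin N)) : PhaseSpace N :=
  WithLp.toLp 2 fun jk => if jk.2 = 0 then q jk.1 else p jk.1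

theorem pos_phasePoint (q p : EuclideanSpace ℝ (Fin N)) : (phasePoint q p).pos = q := by
  ext j; simp [PhaseSpace.pos, phasePoint]

theorem mom_phasePoint (q p : EuclideanSpace ℝ (Fin N)) : (phasePoint q p).mom = p := by
  ext j; simp [PhaseSpace.mom, phasePoint]

theorem continuous_phasePoint (q : EuclideanSpace ℝ (Fin N)) :
    Continuous fun p => phasePoint q p := by
  unfold phasePoint
  refine (PiLp.continuous_toLp 2 _).comp (continuous_pi fun jk => ?_)
  split_ifs <;> fun_prop

/-- The cross-correlation density of a wave function with its translate by `q`. -/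
noncomputable def correlation (ψ : ModeSpace N) (q t : EuclideanSpace ℝ (Fin N)) : ℂ :=
  ⟪ψ t, ψ (t - q)⟫_ℂ

theorem integrable_correlation (ψ : ModeSpace N) (q : EuclideanSpace ℝ (Fin N)) :
    Integrable (correlation ψ q) := by
  refine (L2.integrable_inner (𝕜 := ℂ) ψ (weyl (phasePoint q 0) ψ)).congr ?_
  filter_upwards [coeFn_weyl (phasePoint q 0) ψ] with t ht
  rw [ht, weylFun, pos_phasePoint, mom_phasePoint]
  simp [correlation]

/-- Up to a phase, `p ↦ ⟨ψ, W(q, p) ψ⟩` is the Fourier transform of the correlation at `q`. -/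
theorem fourier_correlation (ψ : ModeSpace N) (q p : EuclideanSpace ℝ (Fin N)) :
    𝓕 (correlation ψ q) p =
      Complex.exp (-(Real.pi * (p ⬝ᵥ q : ℝ) * Complex.I)) *
        ⟪ψ, weyl (phasePoint q (-(2 * Real.pi) • p)) ψ⟫_ℂ := by
  rw [Real.fourier_eq', L2.inner_def, ← integral_const_mul]
  refine integral_congr_ae ?_
  filter_upwards [coeFn_weyl (phasePoint q (-(2 * Real.pi) • p)) ψ] with t ht
  rw [ht, weylFun, pos_phasePoint, mom_phasePoint, correlation]
  simp only [RCLike.inner_apply, smul_eq_mul]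
  -- The momentum `-2πp` matches the Fourier kernel `exp(-2πi⟨t, p⟩)`; the prefactor cancels the
  -- Weyl phase `exp(iπ p·q)`.
  have he : Complex.exp (((-2 * Real.pi * ⟪t, p⟫_ℝ : ℝ) : ℂ) * Complex.I) =
      Complex.exp (-(Real.pi * (p ⬝ᵥ q : ℝ) * Complex.I)) *
        Complex.exp (Complex.I * (((-(2 * Real.pi) • p).ofLp ⬝ᵥ t.ofLp -
          ((-(2 * Real.pi) • p).ofLp ⬝ᵥ q.ofLp) / 2 : ℝ) : ℂ)) := by
    rw [← Complex.exp_add, EuclideanSpace.inner_eq_star_dotProduct, WithLp.ofLp_smul,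
      smul_dotProduct, smul_dotProduct]
    congr 1
    simp only [star_trivial, smul_eq_mul]
    push_cast
    ring
  rw [he]
  ring

/-- The correlation is known only to be integrable, so instead of inverting its transform, the
Fourier transform is moved onto the Schwartz factor, with `G = 𝓕 (𝓕⁻ G)`. -/
theorem integral_mul_correlation (G : 𝓢(EuclideanSpace ℝ (Fin N), ℂ)) (ψ : ModeSpace N)
    (q : EuclideanSpace ℝ (Fin N)) :
    ∫ t, G t * correlation ψ q t =
      ∫ p : EuclideanSpace ℝ (Fin N), (𝓕⁻ G) p * (Complex.exp (-(Real.pi * (p ⬝ᵥ q : ℝ) * Complex.I)) *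
        ⟪ψ, weyl (phasePoint q (-(2 * Real.pi) • p)) ψ⟫_ℂ) := by
  simp only [← fourier_correlation]
  have h := VectorFourier.integral_fourierIntegral_smul_eq_flip (L := innerₗ _) (μ := volume)
    (ν := volume) (f := (𝓕⁻ G : 𝓢(EuclideanSpace ℝ (Fin N), ℂ))) (g := correlation ψ q)
    Real.continuous_fourierChar continuous_inner (SchwartzMap.integrable _)
    (integrable_correlation ψ q)
  rw [flip_innerₗ] at h
  have hG : (VectorFourier.fourierIntegral Real.fourierChar volume (innerₗ _)
      (𝓕⁻ G : 𝓢(EuclideanSpace ℝ (Fin N), ℂ))) = G := by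
    change 𝓕 ((𝓕⁻ G : 𝓢(EuclideanSpace ℝ (Fin N), ℂ)) : EuclideanSpace ℝ (Fin N) → ℂ) = G
    rw [← SchwartzMap.fourier_coe, FourierTransform.fourier_fourierInv_eq]
  rw [hG] at h
  exact h

/-- The bound `‖ψ i‖²` on Weyl matrix elements allows the exchange of sum and integral, after which
the mixture enters only through `tr(ρ W)`. -/
theorem tsum_integral_mul_correlation {κ : Type*} [Countable κ] {ψ : κ → ModeSpace N}
    (hψ : Summable fun i => ‖ψ i‖ ^ 2) (G : 𝓢(EuclideanSpace ℝ (Fin N), ℂ))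
    (q : EuclideanSpace ℝ (Fin N)) :
    ∑' i, ∫ t, G t * correlation (ψ i) q t =
      ∫ p : EuclideanSpace ℝ (Fin N), (𝓕⁻ G) p * (Complex.exp (-(Real.pi * (p ⬝ᵥ q : ℝ) * Complex.I)) *
        ∑' i, ⟪ψ i, weyl (phasePoint q (-(2 * Real.pi) • p)) (ψ i)⟫_ℂ) := by
  simp only [integral_mul_correlation, ← tsum_mul_left]
  set K : 𝓢(EuclideanSpace ℝ (Fin N), ℂ) := 𝓕⁻ G
  have hbound : ∀ i (p : EuclideanSpace ℝ (Fin N)), ‖Complex.exp (-(Real.pi * (p ⬝ᵥ q : ℝ) * Complex.I)) *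
      ⟪ψ i, weyl (phasePoint q (-(2 * Real.pi) • p)) (ψ i)⟫_ℂ‖ ≤ ‖ψ i‖ ^ 2 := fun i p => by
    rw [← neg_mul, ← Complex.ofReal_mul, ← Complex.ofReal_neg, norm_mul,
      Complex.norm_exp_ofReal_mul_I, one_mul]
    refine (norm_inner_le_norm _ _).trans_eq ?_
    rw [norm_weyl, sq]
  have hcont : ∀ i, Continuous fun p : EuclideanSpace ℝ (Fin N) =>
      Complex.exp (-(Real.pi * (p ⬝ᵥ q : ℝ) * Complex.I)) *
      ⟪ψ i, weyl (phasePoint q (-(2 * Real.pi) • p)) (ψ i)⟫_ℂ := fun i => by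
    refine Continuous.mul (by simp only [dotProduct]; fun_prop) (continuous_const.inner ?_)
    exact (continuous_weyl (ψ i)).comp ((continuous_phasePoint q).comp (continuous_const_smul _))
  have hint : ∀ i, Integrable fun p : EuclideanSpace ℝ (Fin N) => K p *
      (Complex.exp (-(Real.pi * (p ⬝ᵥ q : ℝ) * Complex.I)) *
      ⟪ψ i, weyl (phasePoint q (-(2 * Real.pi) • p)) (ψ i)⟫_ℂ) := fun i =>
    K.integrable.mul_bdd (hcont i).aestronglyMeasurable
      (Filter.Eventually.of_forall (hbound i))
  refine (hasSum_integral_of_summable_integral_norm hint ?_).tsum_eq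
  refine Summable.of_nonneg_of_le (fun i => integral_nonneg fun p => norm_nonneg _) (fun i => ?_)
    (hψ.mul_left (∫ p, ‖K p‖))
  rw [← integral_mul_const]
  refine integral_mono (hint i).norm (K.integrable.norm.mul_const _) fun p => ?_
  rw [norm_mul]
  exact mul_le_mul_of_nonneg_left (hbound i p) (norm_nonneg _)

theorem integral_norm_inner_le (φ ψ : ModeSpace N) :
    ∫ t, ‖⟪φ t, ψ t⟫_ℂ‖ ≤ ‖φ‖ * ‖ψ‖ := by
  rw [integral_norm_eq_lintegral_enorm (L2.integrable_inner φ ψ).aestronglyMeasurable,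
    ← eLpNorm_one_eq_lintegral_enorm, Lp.norm_def, Lp.norm_def, ← ENNReal.toReal_mul]
  refine ENNReal.toReal_mono (ENNReal.mul_ne_top (Lp.eLpNorm_ne_top φ) (Lp.eLpNorm_ne_top ψ)) ?_
  have h := eLpNorm_le_eLpNorm_mul_eLpNorm_of_nnnorm (p := 2) (q := 2) (r := 1)
    (Lp.aestronglyMeasurable φ) (Lp.aestronglyMeasurable ψ) (fun a b => ⟪a, b⟫_ℂ) 1
    (Filter.Eventually.of_forall fun t => by
      rw [one_mul]; exact nnnorm_inner_le_nnnorm (𝕜 := ℂ) _ _)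
  simpa using h

/-- The convolution whose integral is `⟨ψ, φ⟩ ⟨χ, ψ⟩`. -/
noncomputable def innerConvolution (φ χ ψ : ModeSpace N) (q : EuclideanSpace ℝ (Fin N)) : ℂ :=
  ∫ t, ⟪ψ t, φ t⟫_ℂ * ⟪χ (t - q), ψ (t - q)⟫_ℂ

theorem innerConvolution_eq (φ χ ψ : ModeSpace N) :
    innerConvolution φ χ ψ =
      (fun t => ⟪ψ t, φ t⟫_ℂ) ⋆[ContinuousLinearMap.mul ℝ ℂ] fun t => ⟪χ (-t), ψ (-t)⟫_ℂ := by
  ext q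
  simp only [innerConvolution, convolution_def, ContinuousLinearMap.mul_apply', neg_sub]

theorem integrable_innerConvolution (φ χ ψ : ModeSpace N) :
    Integrable (innerConvolution φ χ ψ) := by
  rw [innerConvolution_eq]
  exact (L2.integrable_inner ψ φ).integrable_convolution _
    (L2.integrable_inner (𝕜 := ℂ) χ ψ).comp_neg

/-- The integral of a convolution is the product of the integrals. This slices a matrix element of
`|ψ⟩⟨ψ|` along the displacement `q`. -/
theorem integral_innerConvolution (φ χ ψ : ModeSpace N) :
    ∫ q, innerConvolution φ χ ψ q = ⟪χ, ψ⟫_ℂ * ⟪ψ, φ⟫_ℂ := by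
  rw [innerConvolution_eq, integral_convolution _ (L2.integrable_inner ψ φ)
    (L2.integrable_inner (𝕜 := ℂ) χ ψ).comp_neg,
    integral_neg_eq_self (fun t => ⟪χ t, ψ t⟫_ℂ), ContinuousLinearMap.mul_apply', L2.inner_def,
    L2.inner_def, mul_comm]

/-- The bound is quadratic in `ψ`, hence summable over the mixture of a state. -/
theorem integral_norm_innerConvolution_le (φ χ ψ : ModeSpace N) :
    ∫ q, ‖innerConvolution φ χ ψ q‖ ≤ ‖φ‖ * ‖χ‖ * ‖ψ‖ ^ 2 := by
  have ha := (L2.integrable_inner (𝕜 := ℂ) ψ φ).norm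
  have hb := (L2.integrable_inner (𝕜 := ℂ) χ ψ).comp_neg.norm
  calc ∫ q, ‖innerConvolution φ χ ψ q‖
      ≤ ∫ q, ((fun t => ‖⟪ψ t, φ t⟫_ℂ‖) ⋆[ContinuousLinearMap.mul ℝ ℝ]
          fun t => ‖⟪χ (-t), ψ (-t)⟫_ℂ‖) q := by
        refine integral_mono (integrable_innerConvolution φ χ ψ).norm
          (ha.integrable_convolution _ hb) fun q => ?_
        rw [innerConvolution, convolution_def]
        refine (norm_integral_le_integral_norm _).trans_eq ?_
        simp only [norm_mul, ContinuousLinearMap.mul_apply', neg_sub]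
    _ = (∫ t, ‖⟪ψ t, φ t⟫_ℂ‖) * ∫ t, ‖⟪χ t, ψ t⟫_ℂ‖ := by
        rw [integral_convolution _ ha hb, ContinuousLinearMap.mul_apply',
          integral_neg_eq_self (fun t => ‖⟪χ t, ψ t⟫_ℂ‖)]
    _ ≤ (‖ψ‖ * ‖φ‖) * (‖χ‖ * ‖ψ‖) := by
        gcongr
        · exact integral_norm_inner_le ψ φ
        · exact integral_norm_inner_le χ ψ
    _ = ‖φ‖ * ‖χ‖ * ‖ψ‖ ^ 2 := by ring

/-- The Schwartz function `t ↦ g(t) * conj (h(t - q))`. -/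
noncomputable def schwartzCross (g h : 𝓢(EuclideanSpace ℝ (Fin N), ℂ))
    (q : EuclideanSpace ℝ (Fin N)) : 𝓢(EuclideanSpace ℝ (Fin N), ℂ) :=
  SchwartzMap.pairing (ContinuousLinearMap.mul ℝ ℂ) g
    ((h.postcompCLM (Complex.conjCLE : ℂ →L[ℝ] ℂ)).compSubConstCLM ℝ q)

theorem innerConvolution_schwartz (g h : 𝓢(EuclideanSpace ℝ (Fin N), ℂ)) (ψ : ModeSpace N)
    (q : EuclideanSpace ℝ (Fin N)) :
    innerConvolution (g.toLp 2) (h.toLp 2) ψ q =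
      ∫ t, schwartzCross g h q t * correlation ψ q t := by
  refine integral_congr_ae ?_
  have hh := (measurePreserving_sub_right volume q).quasiMeasurePreserving.ae
    (h.coeFn_toLp 2 volume)
  filter_upwards [g.coeFn_toLp 2 volume, hh] with t h1 h2
  rw [h1, h2]
  simp only [correlation, schwartzCross, SchwartzMap.pairing_apply_apply,
    SchwartzMap.compSubConstCLM_apply, SchwartzMap.postcompCLM_apply, RCLike.inner_apply,
    ContinuousLinearMap.mul_apply', ContinuousLinearEquiv.coe_coe, Complex.conjCLE_apply]
  ring

theorem countable_basisSet_modeSpace (N : ℕ) : Countable (basisSet (ModeSpace N)) := by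
  have : Fact ((2 : ENNReal) ≠ ⊤) := ⟨ENNReal.ofNat_ne_top⟩
  exact countable_basisSet

/-- The matrix elements of a state in terms of its characteristic function. -/
theorem IsState.inner_eq_integral_trace_weyl {ρ : ModeSpace N →L[ℂ] ModeSpace N} (hρ : IsState ρ)
    (g h : 𝓢(EuclideanSpace ℝ (Fin N), ℂ)) :
    ⟪(h.toLp 2 : ModeSpace N), ρ (g.toLp 2)⟫_ℂ =
      ∫ q : EuclideanSpace ℝ (Fin N), ∫ p : EuclideanSpace ℝ (Fin N), (𝓕⁻ (schwartzCross g h q)) p *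
        (Complex.exp (-(Real.pi * (p ⬝ᵥ q : ℝ) * Complex.I)) *
          trace (ρ * weyl (phasePoint q (-(2 * Real.pi) • p)))) := by
  have := countable_basisSet_modeSpace N
  obtain ⟨ψ, hψ, ht, hm⟩ := hρ.exists_mixture
  simp only [hm, ht, ← tsum_integral_mul_correlation hψ.summable, ← innerConvolution_schwartz,
    ← integral_innerConvolution]
  refine (hasSum_integral_of_summable_integral_norm
    (fun i => integrable_innerConvolution _ _ _) ?_).tsum_eq
  exact Summable.of_nonneg_of_le (fun i => integral_nonneg fun p => norm_nonneg _)
    (fun i => integral_norm_innerConvolution_le _ _ _) (hψ.summable.mul_left _)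

/-- Matrix elements between Schwartz functions depend only on the characteristic function, and
Schwartz functions are dense. -/
theorem IsState.ext_of_trace_weyl {ρ σ : ModeSpace N →L[ℂ] ModeSpace N} (hρ : IsState ρ)
    (hσ : IsState σ) (h : ∀ x, trace (ρ * weyl x) = trace (σ * weyl x)) : ρ = σ := by
  have hd := denseRange_schwartz_toLp (N := N)
  refine ContinuousLinearMap.ext fun u => ?_
  refine congrFun (hd.equalizer ρ.continuous σ.continuous (funext fun g => ?_)) u
  refine ext_inner_left ℂ fun v => ?_
  refine congrFun (hd.equalizer (g := fun v => ⟪v, ρ (g.toLp 2)⟫_ℂ)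
    (h := fun v => ⟪v, σ (g.toLp 2)⟫_ℂ) (by fun_prop) (by fun_prop) (funext fun k => ?_)) v
  simp only [Function.comp_apply]
  rw [hρ.inner_eq_integral_trace_weyl, hσ.inner_eq_integral_trace_weyl]
  simp only [h]

end Reconstruction

/-! ### Continuous mixtures of pure states -/

section ContinuousMixture

variable {H : Type*} [NormedAddCommGroup H] [InnerProductSpace ℂ H] [CompleteSpace H]
  {X : Type*} [TopologicalSpace X] [MeasurableSpace X] [OpensMeasurableSpace X]
  [SecondCountableTopology X] {μ : Measure X} {f : X → ℝ} {Ψ : X → H}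

/-- The mixture `∫ f(x) |Ψ(x)⟩⟨Ψ(x)| dμ(x)`. -/
noncomputable def continuousMixture (μ : Measure X) (f : X → ℝ) (Ψ : X → H) : H →L[ℂ] H :=
  ∫ x, f x • InnerProductSpace.rankOne ℂ (Ψ x) (Ψ x) ∂μ

theorem inner_continuousMixture (hf : Integrable f μ) (hΨ : Continuous Ψ)
    (hn : ∀ x, ‖Ψ x‖ = 1) (u v : H) :
    ⟪u, continuousMixture μ f Ψ v⟫_ℂ = ∫ x, (f x : ℂ) * (⟪u, Ψ x⟫_ℂ * ⟪Ψ x, v⟫_ℂ) ∂μ := by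
  have hint : Integrable (fun x => f x • InnerProductSpace.rankOne ℂ (Ψ x) (Ψ x)) μ := by
    refine Integrable.smul_bdd (C := 1) hf (Continuous.aestronglyMeasurable ?_)
      (Filter.Eventually.of_forall fun x => ?_)
    -- This form exhibits the rank-one operator as norm continuous in `Ψ x`, as the Bochner integral
    -- in operator norm requires.
    · change Continuous fun x => ContinuousLinearMap.smulRightL ℂ H H (innerSL ℂ (Ψ x)) (Ψ x)
      exact ((ContinuousLinearMap.smulRightL ℂ H H).continuous.comp
        ((innerSL ℂ).continuous.comp hΨ)).clm_apply hΨ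
    · simp [hn]
  rw [continuousMixture, ContinuousLinearMap.integral_apply hint,
    ← integral_inner (hint.apply_continuousLinearMap v)]
  refine integral_congr_ae (Filter.Eventually.of_forall fun x => ?_)
  simp only [_root_.smul_apply, InnerProductSpace.rankOne_apply, inner_smul_right,
    inner_smul_right_eq_smul, Complex.real_smul]
  ring

theorem isPositive_continuousMixture (hf : Integrable f μ) (h0 : ∀ x, 0 ≤ f x)
    (hΨ : Continuous Ψ) (hn : ∀ x, ‖Ψ x‖ = 1) : (continuousMixture μ f Ψ).IsPositive := by
  have h : ∀ v, ⟪v, continuousMixture μ f Ψ v⟫_ℂ = ((∫ x, f x * ‖⟪Ψ x, v⟫_ℂ‖ ^ 2 ∂μ : ℝ) : ℂ) := by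
    intro v
    rw [inner_continuousMixture hf hΨ hn, ← integral_complex_ofReal]
    refine integral_congr_ae (Filter.Eventually.of_forall fun x => ?_)
    simp only
    rw [← inner_conj_symm v, mul_comm (starRingEnd ℂ _), Complex.mul_conj,
      Complex.normSq_eq_norm_sq]
    norm_cast
  rw [ContinuousLinearMap.isPositive_iff_complex]
  intro v
  rw [← inner_conj_symm, h, Complex.conj_ofReal]
  exact ⟨by simp, by
    simpa using integral_nonneg fun x => mul_nonneg (h0 x) (sq_nonneg ‖⟪Ψ x, v⟫_ℂ‖)⟩

/-- Parseval's identity at each `x`, integrated by dominated convergence: the dominating terms sum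
to `f x * (1 + ‖Td (Ψ x)‖²)`, which is integrable. The case `T = 1` gives trace one. -/
theorem hasSum_inner_continuousMixture {κ : Type*} [Countable κ] (b : HilbertBasis κ ℂ H)
    (hf : Integrable f μ) (h0 : ∀ x, 0 ≤ f x) (hΨ : Continuous Ψ) (hn : ∀ x, ‖Ψ x‖ = 1)
    (T : H →L[ℂ] H) :
    HasSum (fun i => ⟪b i, continuousMixture μ f Ψ (T (b i))⟫_ℂ)
      (∫ x, (f x : ℂ) * ⟪Ψ x, T (Ψ x)⟫_ℂ ∂μ) := by
  set Td := ContinuousLinearMap.adjoint T with hTd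
  simp only [inner_continuousMixture hf hΨ hn, ← ContinuousLinearMap.adjoint_inner_left T, ← hTd]
  have hb : ∀ x, HasSum (fun i => f x * (‖⟪b i, Ψ x⟫_ℂ‖ ^ 2 + ‖⟪b i, Td (Ψ x)⟫_ℂ‖ ^ 2))
      (f x * (1 + ‖Td (Ψ x)‖ ^ 2)) := fun x => by
    have h := hasSum_norm_inner_sq b (Ψ x)
    rw [hn, one_pow] at h
    exact (h.add (hasSum_norm_inner_sq b (Td (Ψ x)))).mul_left _
  refine hasSum_integral_of_dominated_convergence
    (fun i x => f x * (‖⟪b i, Ψ x⟫_ℂ‖ ^ 2 + ‖⟪b i, Td (Ψ x)⟫_ℂ‖ ^ 2)) (fun i => ?_)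
    (fun i => Filter.Eventually.of_forall fun x => ?_)
    (Filter.Eventually.of_forall fun x => (hb x).summable) ?_
    (Filter.Eventually.of_forall fun x => ?_)
  · refine (Complex.continuous_ofReal.comp_aestronglyMeasurable hf.aestronglyMeasurable).mul ?_
    exact Continuous.aestronglyMeasurable (by fun_prop)
  · rw [norm_mul, norm_mul, Complex.norm_real, Real.norm_of_nonneg (h0 x),
      norm_inner_symm (Td (Ψ x))]
    refine mul_le_mul_of_nonneg_left ?_ (h0 x)
    nlinarith [sq_nonneg (‖⟪b i, Ψ x⟫_ℂ‖ - ‖⟪b i, Td (Ψ x)⟫_ℂ‖),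
      sq_nonneg ‖⟪b i, Ψ x⟫_ℂ‖, sq_nonneg ‖⟪b i, Td (Ψ x)⟫_ℂ‖]
  · simp only [fun x => (hb x).tsum_eq]
    refine hf.mul_bdd (c := 1 + ‖Td‖ ^ 2) (Continuous.aestronglyMeasurable (by fun_prop))
      (Filter.Eventually.of_forall fun x => ?_)
    rw [Real.norm_of_nonneg (by positivity)]
    have := Td.le_opNorm (Ψ x)
    rw [hn, mul_one] at this
    gcongr
  · refine HasSum.mul_left _ ?_
    simpa only [mul_comm] using b.hasSum_inner_mul_inner (Td (Ψ x)) (Ψ x)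

theorem isState_continuousMixture [Countable (basisSet H)] (hf : Integrable f μ)
    (h0 : ∀ x, 0 ≤ f x) (h1 : ∫ x, f x ∂μ = 1) (hΨ : Continuous Ψ) (hn : ∀ x, ‖Ψ x‖ = 1) :
    IsState (continuousMixture μ f Ψ) where
  isPositive := isPositive_continuousMixture hf h0 hΨ hn
  hasSum_one := by
    have h := hasSum_inner_continuousMixture (basis H) hf h0 hΨ hn 1
    simp only [one_apply_eq_self, inner_self_eq_norm_sq_to_K, hn] at h
    convert h using 1
    simp only [RCLike.ofReal_one, one_pow, mul_one]
    rw [integral_complex_ofReal, h1, Complex.ofReal_one]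

theorem trace_continuousMixture_mul [Countable (basisSet H)] (hf : Integrable f μ)
    (h0 : ∀ x, 0 ≤ f x) (hΨ : Continuous Ψ) (hn : ∀ x, ‖Ψ x‖ = 1) (T : H →L[ℂ] H) :
    trace (continuousMixture μ f Ψ * T) = ∫ x, (f x : ℂ) * ⟪Ψ x, T (Ψ x)⟫_ℂ ∂μ :=
  (hasSum_inner_continuousMixture (basis H) hf h0 hΨ hn T).tsum_eq

end ContinuousMixture

/-! ### Probability densities whose Fourier transforms differ only on a small set -/

section Densities

open scoped SchwartzMap FourierTransform

variable {V : Type*} [NormedAddCommGroup V] [InnerProductSpace ℝ V] [FiniteDimensional ℝ V]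
  [MeasurableSpace V] [BorelSpace V]

theorem fourier_linear_combination {F G : V → ℂ} (hF : Integrable F) (hG : Integrable G) (a b : ℂ)
    (w : V) : 𝓕 (fun x => a * F x + b * G x) w = a * 𝓕 F w + b * 𝓕 G w := by
  have hexp : Continuous fun x : V =>
      Complex.exp (((-2 * Real.pi * ⟪x, w⟫_ℝ : ℝ) : ℂ) * Complex.I) := by fun_prop
  have hint : ∀ {K : V → ℂ}, Integrable K → Integrable fun x =>
      Complex.exp (((-2 * Real.pi * ⟪x, w⟫_ℝ : ℝ) : ℂ) * Complex.I) • K x := fun hK =>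
    hK.bdd_smul 1 hexp.aestronglyMeasurable
      (Filter.Eventually.of_forall fun x => by rw [Complex.norm_exp_ofReal_mul_I])
  rw [Real.fourier_eq', Real.fourier_eq', Real.fourier_eq', ← integral_const_mul,
    ← integral_const_mul, ← integral_add ((hint hF).const_mul a) ((hint hG).const_mul b)]
  refine integral_congr_ae (Filter.Eventually.of_forall fun x => ?_)
  simp only [smul_eq_mul]
  ring

theorem fourier_conj (F : V → ℂ) (w : V) :
    𝓕 (fun x => starRingEnd ℂ (F x)) w = starRingEnd ℂ (𝓕 F (-w)) := by
  rw [Real.fourier_eq', Real.fourier_eq', ← integral_conj]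
  refine integral_congr_ae (Filter.Eventually.of_forall fun x => ?_)
  simp only [smul_eq_mul, map_mul, ← Complex.exp_conj, Complex.conj_ofReal, Complex.conj_I,
    inner_neg_right]
  congr 2
  push_cast
  ring

/-- The inverse transform of a bump `φ` need not be real. Its real part has transform `(φ(w) +
φ(-w))/2`, which is why `-O` appears; `φ ≥ 0` prevents cancellation at `w₀`. -/
theorem exists_integrable_fourier_bump {O : Set V} {w₀ : V} (hO : O ∈ nhds w₀) :
    ∃ f : V → ℝ, Integrable f ∧ 𝓕 (fun x => (f x : ℂ)) w₀ ≠ 0 ∧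
      ∀ w, w ∉ O → -w ∉ O → 𝓕 (fun x => (f x : ℂ)) w = 0 := by
  obtain ⟨φ, hsupp, hcs, hsm, hrange, hφ⟩ := exists_contDiff_tsupport_subset (n := ⊤) hO
  have hnn : ∀ w, 0 ≤ φ w := fun w => (hrange ⟨w, rfl⟩).1
  have hzero : ∀ w, w ∉ O → φ w = 0 := fun w hw =>
    image_eq_zero_of_notMem_tsupport fun h => hw (hsupp h)
  have hcs' : HasCompactSupport fun w => (φ w : ℂ) := hcs.comp_left Complex.ofReal_zero
  let Φ : 𝓢(V, ℂ) := hcs'.toSchwartzMap (Complex.ofRealCLM.contDiff.comp hsm)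
  have hΦ : ∀ w, Φ w = φ w := fun w => rfl
  let F : 𝓢(V, ℂ) := 𝓕⁻ Φ
  have hF : 𝓕 (F : V → ℂ) = Φ := by
    rw [← SchwartzMap.fourier_coe, FourierTransform.fourier_fourierInv_eq]
  have hFint : Integrable (F : V → ℂ) := F.integrable
  have hconj : Integrable fun x => starRingEnd ℂ (F x) :=
    Complex.conjCLE.toContinuousLinearMap.integrable_comp hFint
  have hfour : ∀ w, 𝓕 (fun x => (((F x).re : ℝ) : ℂ)) w = (((φ w + φ (-w)) / 2 : ℝ) : ℂ) := by
    intro w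
    have he : (fun x => (((F x).re : ℝ) : ℂ)) =
        fun x => 2⁻¹ * F x + 2⁻¹ * starRingEnd ℂ (F x) := by
      ext x
      rw [Complex.re_eq_add_conj]
      ring
    rw [he, fourier_linear_combination hFint hconj, fourier_conj, hF, hΦ, hΦ, Complex.conj_ofReal]
    push_cast
    ring
  refine ⟨fun x => (F x).re, hFint.re, ?_, fun w hw hw' => ?_⟩
  · rw [hfour, hφ]
    have := hnn (-w₀)
    exact_mod_cast (by positivity : (1 + φ (-w₀)) / 2 ≠ 0)
  · rw [hfour, hzero w hw, hzero (-w) hw']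
    simp

/-- The densities are the normalized positive and negative parts of the function `f` with bump
transform; their transforms differ by a nonzero multiple of that of `f`. -/
theorem exists_densities_fourier_eq_off {O : Set V} {w₀ : V} (hO : O ∈ nhds w₀) (h0 : 0 ∉ O) :
    ∃ f₁ f₂ : V → ℝ, Integrable f₁ ∧ Integrable f₂ ∧ (∀ x, 0 ≤ f₁ x) ∧ (∀ x, 0 ≤ f₂ x) ∧
      ∫ x, f₁ x = 1 ∧ ∫ x, f₂ x = 1 ∧
      𝓕 (fun x => (f₁ x : ℂ)) w₀ ≠ 𝓕 (fun x => (f₂ x : ℂ)) w₀ ∧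
      ∀ w, w ∉ O → -w ∉ O → 𝓕 (fun x => (f₁ x : ℂ)) w = 𝓕 (fun x => (f₂ x : ℂ)) w := by
  obtain ⟨f, hf, hne, heq⟩ := exists_integrable_fourier_bump hO
  have hp := hf.pos_part
  have hm := hf.neg_part
  have hsub : ∀ x, f x = max (f x) 0 - max (-f x) 0 := fun x =>
    (max_zero_sub_max_neg_zero_eq_self (f x)).symm
  have hpn : ∀ x, 0 ≤ max (f x) 0 := fun x => le_max_right _ _
  have hmn : ∀ x, 0 ≤ max (-f x) 0 := fun x => le_max_right _ _
  set c := ∫ x, max (f x) 0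
  -- Since `0 ∉ O`, the transform of `f` vanishes at `0`: the integral of `f` is zero and both parts
  -- have the same mass.
  have hc2 : ∫ x, max (-f x) 0 = c := by
    have h := heq 0 h0 (by simpa using h0)
    rw [Real.fourier_eq'] at h
    simp only [inner_zero_right, mul_zero, Complex.ofReal_zero, zero_mul, Complex.exp_zero,
      one_smul, integral_complex_ofReal, Complex.ofReal_eq_zero] at h
    rw [integral_congr_ae (Filter.Eventually.of_forall hsub), integral_sub hp hm] at h
    linarith
  have hc : c ≠ 0 := fun hc => hne <| by
    have h1 := (integral_eq_zero_iff_of_nonneg hpn hp).1 hc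
    have h2 := (integral_eq_zero_iff_of_nonneg hmn hm).1 (hc2.trans hc)
    rw [Real.fourier_eq']
    refine integral_eq_zero_of_ae ?_
    filter_upwards [h1, h2] with x h1 h2
    have : f x = 0 := by rw [hsub x, h1, h2]; simp
    simp [this]
  have hfour : ∀ w, 𝓕 (fun x => (f x : ℂ)) w =
      c * (𝓕 (fun x => ((c⁻¹ * max (f x) 0 : ℝ) : ℂ)) w -
        𝓕 (fun x => ((c⁻¹ * max (-f x) 0 : ℝ) : ℂ)) w) := by
    intro w
    have h := fourier_linear_combination (F := fun x => ((c⁻¹ * max (f x) 0 : ℝ) : ℂ))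
      (G := fun x => ((c⁻¹ * max (-f x) 0 : ℝ) : ℂ)) (hp.const_mul c⁻¹).ofReal
      (hm.const_mul c⁻¹).ofReal (c : ℂ) (-c : ℂ) w
    rw [mul_sub, sub_eq_add_neg, ← neg_mul]
    refine Eq.trans ?_ h
    refine congrArg (fun k : V → ℂ => 𝓕 k w) (funext fun x => ?_)
    rw [← Complex.ofReal_neg, ← Complex.ofReal_mul, ← Complex.ofReal_mul, ← Complex.ofReal_add,
      neg_mul, mul_inv_cancel_left₀ hc, mul_inv_cancel_left₀ hc, ← sub_eq_add_neg, ← hsub x]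
  have hcpos : 0 ≤ c⁻¹ := inv_nonneg.2 (integral_nonneg hpn)
  refine ⟨fun x => c⁻¹ * max (f x) 0, fun x => c⁻¹ * max (-f x) 0, hp.const_mul _, hm.const_mul _,
    fun x => mul_nonneg hcpos (hpn x), fun x => mul_nonneg hcpos (hmn x), ?_, ?_, ?_, ?_⟩
  · rw [integral_const_mul, inv_mul_cancel₀ hc]
  · rw [integral_const_mul, hc2, inv_mul_cancel₀ hc]
  · intro h
    exact hne (by rw [hfour, h, sub_self, mul_zero])
  · intro w hw hw'
    have h := heq w hw hw'
    rw [hfour, mul_eq_zero, Complex.ofReal_eq_zero] at h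
    exact sub_eq_zero.1 (h.resolve_left hc)

end Densities

/-! ### States with characteristic functions that agree off a small set -/

section Separation

open scoped FourierTransform

variable {N : ℕ}

/-- The phase space point `z` such that conjugating `W(z)` by `W(x)` yields the phase
`exp(-2πi ⟨x, w⟩)`. -/
noncomputable def dualPoint (w : PhaseSpace N) : PhaseSpace N :=
  (2 * Real.pi) • WithLp.toLp 2 fun jk => if jk.2 = 0 then w (jk.1, 1) else -w (jk.1, 0)

theorem continuous_dualPoint : Continuous (dualPoint (N := N)) := by
  have h : Continuous fun w : PhaseSpace N => (WithLp.toLp 2 fun jk : Fin N × Fin 2 =>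
      if jk.2 = 0 then w (jk.1, 1) else -w (jk.1, 0) : PhaseSpace N) := by
    refine (PiLp.continuous_toLp 2 _).comp (continuous_pi fun jk => ?_)
    split_ifs <;> fun_prop
  exact h.const_smul (2 * Real.pi)

theorem dualPoint_neg (w : PhaseSpace N) : dualPoint (-w) = -dualPoint w := by
  ext jk; simp only [dualPoint]; by_cases h : jk.2 = 0 <;> simp [h]

theorem dualPoint_zero : dualPoint (0 : PhaseSpace N) = 0 := by
  ext jk; simp [dualPoint]

theorem dualPoint_surjective : Function.Surjective (dualPoint (N := N)) := by
  intro z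
  refine ⟨(2 * Real.pi)⁻¹ • WithLp.toLp 2 fun jk =>
    if jk.2 = 0 then -z (jk.1, 1) else z (jk.1, 0), ?_⟩
  have hpi : (2 * Real.pi) ≠ 0 := by positivity
  ext ⟨j, k⟩
  fin_cases k <;> simp [dualPoint] <;> field_simp

theorem mom_dualPoint_sub (w x : PhaseSpace N) :
    (dualPoint w).mom ⬝ᵥ x.pos - x.mom ⬝ᵥ (dualPoint w).pos = -2 * Real.pi * ⟪x, w⟫_ℝ := by
  rw [PiLp.inner_apply, Fintype.sum_prod_type, dotProduct, dotProduct, ← Finset.sum_sub_distrib,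
    Finset.mul_sum]
  refine Finset.sum_congr rfl fun j _ => ?_
  simp [PhaseSpace.mom, PhaseSpace.pos, dualPoint]
  ring

/-- If every diagonal element vanished, complex polarization would give `W(z) = 0`, impossible for
an isometry of a nonzero space. -/
theorem exists_norm_one_inner_weyl_ne_zero (z : PhaseSpace N) :
    ∃ ψ : ModeSpace N, ‖ψ‖ = 1 ∧ ⟪ψ, weyl z ψ⟫_ℂ ≠ 0 := by
  obtain ⟨χ, hχ⟩ : ∃ χ : ModeSpace N, χ ≠ 0 := by
    refine ⟨indicatorConstLp 2 (measurableSet_ball (x := 0) (ε := 1)) measure_ball_lt_top.ne 1, ?_⟩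
    rw [← norm_ne_zero_iff, norm_indicatorConstLp (by simp) (by simp), norm_one, one_mul]
    have : 0 < (volume : Measure (EuclideanSpace ℝ (Fin N))).real (Metric.ball 0 1) :=
      ENNReal.toReal_pos (Metric.measure_ball_pos _ _ one_pos).ne' measure_ball_lt_top.ne
    positivity
  obtain ⟨ψ, hψ⟩ : ∃ ψ : ModeSpace N, ⟪ψ, weyl z ψ⟫_ℂ ≠ 0 := by
    by_contra! h
    have hz : (weyl z).toLinearMap = 0 := (inner_map_self_eq_zero _).1 fun ψ => by
      rw [← inner_conj_symm]
      exact (congrArg _ (h ψ)).trans (map_zero _)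
    have := norm_weyl z χ
    rw [show weyl z χ = 0 from LinearMap.congr_fun hz χ, norm_zero] at this
    exact hχ (norm_eq_zero.1 this.symm)
  have hn : ψ ≠ 0 := fun h => hψ (by rw [h, inner_zero_left])
  refine ⟨((‖ψ‖⁻¹ : ℝ) : ℂ) • ψ, ?_, ?_⟩
  · rw [norm_smul, Complex.norm_real, norm_inv, norm_norm, inv_mul_cancel₀ (norm_ne_zero_iff.2 hn)]
  · rw [map_smul, inner_smul_left, inner_smul_right]
    have : ((‖ψ‖⁻¹ : ℝ) : ℂ) ≠ 0 := by exact_mod_cast inv_ne_zero (norm_ne_zero_iff.2 hn)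
    exact mul_ne_zero ((map_ne_zero _).2 this) (mul_ne_zero this hψ)

/-- Displacing `ψ` by `x` multiplies `⟨ψ, W(z)ψ⟩` by a character of `x`; averaging over `f` turns it
into a Fourier transform. -/
theorem trace_continuousMixture_weyl {f : PhaseSpace N → ℝ} (hf : Integrable f)
    (h0 : ∀ x, 0 ≤ f x) {ψ : ModeSpace N} (hψ : ‖ψ‖ = 1) (w : PhaseSpace N) :
    trace (continuousMixture volume f (fun x => weyl x ψ) * weyl (dualPoint w)) =
      𝓕 (fun x => (f x : ℂ)) w * ⟪ψ, weyl (dualPoint w) ψ⟫_ℂ := by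
  have := countable_basisSet_modeSpace N
  rw [trace_continuousMixture_mul hf h0 (continuous_weyl ψ) (fun x => (norm_weyl x ψ).trans hψ),
    Real.fourier_eq', ← integral_mul_const]
  refine integral_congr_ae (Filter.Eventually.of_forall fun x => ?_)
  simp only [inner_weyl_conj, mom_dualPoint_sub, smul_eq_mul]
  rw [mul_comm Complex.I]
  ring

/-- For every nonempty open set of nonzero phase space points there are two different states whose
characteristic functions agree at all points `z` such that `z` and `-z` are outside of the set. -/
theorem exists_states_trace_weyl_eq_off {U : Set (PhaseSpace N)} (hU : IsOpen U) (h0 : 0 ∉ U)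
    (hne : U.Nonempty) :
    ∃ ρ σ : ModeSpace N →L[ℂ] ModeSpace N, IsState ρ ∧ IsState σ ∧ ρ ≠ σ ∧
      ∀ z, z ∉ U → -z ∉ U → trace (ρ * weyl z) = trace (σ * weyl z) := by
  have := countable_basisSet_modeSpace N
  obtain ⟨z₀, hz₀⟩ := hne
  obtain ⟨w₀, rfl⟩ := dualPoint_surjective z₀
  obtain ⟨ψ, hψ, hψne⟩ := exists_norm_one_inner_weyl_ne_zero (dualPoint w₀)
  obtain ⟨f₁, f₂, hf₁, hf₂, hn₁, hn₂, hi₁, hi₂, hw₀, heq⟩ :=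
    exists_densities_fourier_eq_off (O := dualPoint ⁻¹' U)
      ((hU.preimage continuous_dualPoint).mem_nhds hz₀)
      (by rwa [Set.mem_preimage, dualPoint_zero])
  have hnorm : ∀ x, ‖weyl x ψ‖ = 1 := fun x => (norm_weyl x ψ).trans hψ
  refine ⟨continuousMixture volume f₁ fun x => weyl x ψ,
    continuousMixture volume f₂ fun x => weyl x ψ,
    isState_continuousMixture hf₁ hn₁ hi₁ (continuous_weyl ψ) hnorm,
    isState_continuousMixture hf₂ hn₂ hi₂ (continuous_weyl ψ) hnorm, fun h => hw₀ ?_,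
    fun z hz hz' => ?_⟩
  · refine mul_right_cancel₀ hψne ?_
    rw [← trace_continuousMixture_weyl hf₁ hn₁ hψ, ← trace_continuousMixture_weyl hf₂ hn₂ hψ, h]
  · obtain ⟨w, rfl⟩ := dualPoint_surjective z
    rw [trace_continuousMixture_weyl hf₁ hn₁ hψ, trace_continuousMixture_weyl hf₂ hn₂ hψ,
      heq w hz (by rwa [Set.mem_preimage, dualPoint_neg])]

end Separation

end GaussianIC

theorem mainTheorem1 (N : ℕ) (hN : 0 < N) {ι : Type*} (m : ι → ℕ)
    (E : (j : ι) → GaussianIC.Observable (GaussianIC.ModeSpace N) (m j))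
    (A : (j : ι) → Matrix (Fin N × Fin 2) (Fin (m j)) ℝ)
    (B : (j : ι) → Matrix (Fin (m j)) (Fin (m j)) ℝ)
    (v : (j : ι) → EuclideanSpace ℝ (Fin (m j)))
    (hE : ∀ j, GaussianIC.IsGaussian (E j) (A j) (B j) (v j)) :
    GaussianIC.InformationallyComplete E ↔
      Dense (⋃ j, (GaussianIC.subspaceOf (A j) : Set (GaussianIC.PhaseSpace N))) := by
  constructor
  · intro hIC
    by_contra hd
    -- Phase space is thus nontrivial, so `{0}ᶜ` is dense and `0` can be removed from the open set
    -- missed by `S`.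
    have : Nonempty (Fin N) := ⟨⟨0, hN⟩⟩
    set S := ⋃ j, (GaussianIC.subspaceOf (A j) : Set (GaussianIC.PhaseSpace N))
    -- The two states may also differ on the reflected open set; the symmetry of a union of
    -- subspaces keeps `S` off it.
    have hneg : ∀ z ∈ S, -z ∈ S := fun z hz => by
      obtain ⟨j, hj⟩ := Set.mem_iUnion.1 hz
      exact Set.mem_iUnion.2 ⟨j, neg_mem hj⟩
    have hne : ((closure S)ᶜ).Nonempty := by
      rw [Set.nonempty_compl]
      exact fun h => hd (dense_iff_closure_eq.2 h)
    have hne' : ((closure S)ᶜ ∩ {0}ᶜ).Nonempty :=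
      (dense_compl_singleton (0 : GaussianIC.PhaseSpace N)).inter_open_nonempty _
        isClosed_closure.isOpen_compl hne
    obtain ⟨ρ, σ, hρ, hσ, hρσ, heq⟩ := GaussianIC.exists_states_trace_weyl_eq_off
      (isClosed_closure.isOpen_compl.inter isOpen_compl_singleton) (fun h => h.2 rfl) hne'
    refine hρσ (hIC ρ σ hρ hσ fun j => ((hE j).outcome_eq_iff hρ hσ).2 fun z hz => ?_)
    have hzS : z ∈ S := Set.mem_iUnion.2 ⟨j, hz⟩
    exact heq z (fun h => h.1 (subset_closure hzS)) fun h => h.1 (subset_closure (hneg z hzS))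
  · intro hd ρ σ hρ hσ h
    refine hρ.ext_of_trace_weyl hσ fun x => congrFun
      (Continuous.ext_on hd hρ.continuous_trace_weyl hσ.continuous_trace_weyl fun z hz => ?_) x
    obtain ⟨j, hj⟩ := Set.mem_iUnion.1 hz
    exact ((hE j).outcome_eq_iff hρ hσ).1 (h j) z hj
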